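/- Let $n\ge 0$ and let $\Omega\subseteq\mathbb{R}^n$ be a convex open set (for example $\Omega=\mathbb{R}^n$) with a Finsler metric $F$: a function $F\colon\Omega\times\mathbb{R}^n\to[0,\infty)$, $(x,v)\mapsto F_x(v)$, that is $C^\infty$ on $\Omega\times(\mathbb{R}^n\setminus\{0\})$, satisfies $F_x(\lambda v)=\lambda F_x(v)$ for all $\lambda>0$, and is such that the Hessian of $F_x^2$ is positive definite at every $v\neq0$. For $p\in\Omega$ and $\varepsilon>0$ let $\mathcal{B}_\varepsilon(p)=\{q\in\Omega : F_p(q-p)<\varepsilon\}$ be the open ball, or throughout $\mathcal{B}_\varepsilon(p)=\{q\in\Omega : F_p(q-p)\le\varepsilon\}$ the closed ball. Let $X\subset\Omega$ be a finite set, and let $\{\Delta_\varepsilon\}_{\varepsilon>0}$ be its Čech filtration: $\Delta_\varepsilon$ is the simplicial complex with vertex set $X$ in which a nonempty subset $\sigma\subseteq X$ is a simplex if and only if $\bigcap_{p\in\sigma}\mathcal{B}_\varepsilon(p)\neq\emptyset$. Then, for either kind of balls and for every field $\Bbbk$ and every integer $k>n$, the simplicial homology satisfies $$H_k(\Delta_\varepsilon;\Bbbk)=0\quad\text{for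 all }\varepsilon>0.$$ In particular, the $k$-th persistence module $\varepsilon\mapsto H_k(\Delta_\varepsilon;\Bbbk)$, a functor from $((0,\infty),\le)$ to $\Bbbk$-vector spaces, is trivial (a zero object) for every $k>n$. -/

import Mathlib

open scoped ContDiff

/-! ### Simplicial homology over a field, and persistence modules -/

namespace SimplicialHomology

section

variable {𝕜 : Type*} [Field 𝕜] {M : Type*} [AddCommGroup M] [Module 𝕜 M]

/-- The quotient `Z / B` of subspaces `B ⊆ Z` of a vector space `M`. -/
def Subquotient (Z B : Submodule 𝕜 M) : Type _ := Z ⧸ B.submoduleOf Z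

instance (Z B : Submodule 𝕜 M) : AddCommGroup (Subquotient Z B) :=
  inferInstanceAs (AddCommGroup (Z ⧸ B.submoduleOf Z))

instance (Z B : Submodule 𝕜 M) : Module 𝕜 (Subquotient Z B) :=
  inferInstanceAs (Module 𝕜 (Z ⧸ B.submoduleOf Z))

/-- The linear map `Z / B → Z' / B'` induced by inclusions `Z ⊆ Z'` and `B ⊆ B'`: the class of `z`
in `Z / B` goes to the class of `z` in `Z' / B'`. -/
def Subquotient.map {Z B Z' B' : Submodule 𝕜 M} (hZ : Z ≤ Z') (hB : B ≤ B') :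
    Subquotient Z B →ₗ[𝕜] Subquotient Z' B' :=
  Submodule.mapQ (B.submoduleOf Z) (B'.submoduleOf Z') (Submodule.inclusion hZ) fun _ hz => hB hz

theorem Subquotient.map_id (Z B : Submodule 𝕜 M) :
    Subquotient.map (le_refl Z) (le_refl B) = LinearMap.id := by
  refine LinearMap.ext fun x => ?_
  obtain ⟨z, rfl⟩ := Submodule.Quotient.mk_surjective _ x
  rfl

theorem Subquotient.map_comp {Z B Z' B' Z'' B'' : Submodule 𝕜 M} (hZ : Z ≤ Z') (hB : B ≤ B')
    (hZ' : Z' ≤ Z'') (hB' : B' ≤ B'') :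
    (Subquotient.map hZ' hB').comp (Subquotient.map hZ hB) =
      Subquotient.map (hZ.trans hZ') (hB.trans hB') := by
  refine LinearMap.ext fun x => ?_
  obtain ⟨z, rfl⟩ := Submodule.Quotient.mk_surjective _ x
  rfl

end

section

variable {V : Type*} (𝕜 : Type*) [Field 𝕜]

/-- The space `C_k(Δ; 𝕜)` of `k`-chains: the linear combinations of the `k`-simplices of `Δ`, that
is, of the simplices of `Δ` with `k + 1` vertices. -/
def chains (Δ : PreAbstractSimplicialComplex V) (k : ℕ) : Submodule 𝕜 (Finset V →₀ 𝕜) :=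
  Finsupp.supported 𝕜 𝕜 {σ : Finset V | σ ∈ Δ.faces ∧ σ.card = k + 1}

variable {𝕜} in
theorem chains_mono {Δ Δ' : PreAbstractSimplicialComplex V} (h : Δ ≤ Δ') (k : ℕ) :
    chains 𝕜 Δ k ≤ chains 𝕜 Δ' k :=
  Finsupp.supported_mono fun _ hσ => ⟨h hσ.1, hσ.2⟩

end

section

variable {V : Type*} [LinearOrder V] (𝕜 : Type*) [Field 𝕜]

/-- The boundary of the simplex `σ = {v₀ < v₁ < ⋯ < v_k}`: the alternating sum
`∑ i, (-1) ^ i • (σ \ {v_i})` of its facets. The index `i` of the vertex `v = v_i` is the number of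
vertices of `σ` below `v`. The boundary of a vertex (the case `k = 0`) is zero, that is, homology is
not reduced. -/
noncomputable def boundarySimplex (σ : Finset V) : Finset V →₀ 𝕜 :=
  if 2 ≤ σ.card then
    ∑ v ∈ σ, Finsupp.single (σ.erase v) ((-1 : 𝕜) ^ (σ.filter (fun w => w < v)).card)
  else 0

/-- The boundary operator, on formal linear combinations of finite sets of vertices. -/
noncomputable def boundary : (Finset V →₀ 𝕜) →ₗ[𝕜] (Finset V →₀ 𝕜) :=
  Finsupp.linearCombination 𝕜 (boundarySimplex 𝕜)

/-- The space `Z_k(Δ; 𝕜)` of `k`-cycles: the `k`-chains with zero boundary. -/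
noncomputable def cycles (Δ : PreAbstractSimplicialComplex V) (k : ℕ) :
    Submodule 𝕜 (Finset V →₀ 𝕜) :=
  chains 𝕜 Δ k ⊓ LinearMap.ker (boundary 𝕜)

/-- The space `B_k(Δ; 𝕜)` of `k`-boundaries: the boundaries of the `(k + 1)`-chains. -/
noncomputable def boundaries (Δ : PreAbstractSimplicialComplex V) (k : ℕ) :
    Submodule 𝕜 (Finset V →₀ 𝕜) :=
  (chains 𝕜 Δ (k + 1)).map (boundary 𝕜)

/-- The `k`-th simplicial homology `H_k(Δ; 𝕜) = Z_k(Δ; 𝕜) / B_k(Δ; 𝕜)`. -/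
abbrev Homology (Δ : PreAbstractSimplicialComplex V) (k : ℕ) : Type _ :=
  Subquotient (cycles 𝕜 Δ k) (boundaries 𝕜 Δ k)

theorem boundary_single (σ : Finset V) :
    boundary 𝕜 (Finsupp.single σ 1) = boundarySimplex 𝕜 σ := by
  simp [boundary]

theorem boundary_boundarySimplex (σ : Finset V) :
    boundary 𝕜 (boundarySimplex 𝕜 σ) = 0 := by
  classical
  unfold boundarySimplex
  split_ifs with h
  swap
  · simp
  rw [map_sum]
  rcases h.eq_or_lt with h2 | h3
  · refine Finset.sum_eq_zero fun v hv => ?_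
    have : ¬ 2 ≤ (σ.erase v).card := by rw [Finset.card_erase_of_mem hv]; omega
    simp [boundary, boundarySimplex, this]
  have key : ∀ v ∈ σ, boundary 𝕜
      (Finsupp.single (σ.erase v) ((-1 : 𝕜) ^ (σ.filter (fun w => w < v)).card)) =
      ∑ w ∈ σ.erase v, Finsupp.single ((σ.erase v).erase w)
        ((-1 : 𝕜) ^ (σ.filter (fun u => u < v)).card *
          (-1 : 𝕜) ^ ((σ.erase v).filter (fun u => u < w)).card) := by
    intro v hv
    have : 2 ≤ (σ.erase v).card := by rw [Finset.card_erase_of_mem hv]; omega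
    simp [boundary, boundarySimplex, this, Finset.smul_sum]
  rw [Finset.sum_congr rfl key, Finset.sum_sigma']
  refine Finset.sum_involution (fun p _ => ⟨p.2, p.1⟩) ?_ ?_ ?_ ?_
  · have main : ∀ v w, v ∈ σ → w ∈ σ → v < w →
        (-1 : 𝕜) ^ (σ.filter (fun u => u < v)).card *
          (-1 : 𝕜) ^ ((σ.erase v).filter (fun u => u < w)).card +
        (-1 : 𝕜) ^ (σ.filter (fun u => u < w)).card *
          (-1 : 𝕜) ^ ((σ.erase w).filter (fun u => u < v)).card = 0 := by
      intro v w hv hw hvw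
      have e1 : (σ.erase w).filter (fun u => u < v) = σ.filter (fun u => u < v) := by
        ext u
        simp only [Finset.mem_filter, Finset.mem_erase]
        exact ⟨fun h => ⟨h.1.2, h.2⟩, fun h => ⟨⟨(h.2.trans hvw).ne, h.1⟩, h.2⟩⟩
      have e2 : ((σ.erase v).filter (fun u => u < w)).card + 1 =
          (σ.filter (fun u => u < w)).card := by
        rw [Finset.filter_erase]
        exact Finset.card_erase_add_one (Finset.mem_filter.2 ⟨hv, hvw⟩)
      rw [e1, ← e2, pow_succ]
      ring
    rintro ⟨v, w⟩ hp
    simp only [Finset.mem_sigma, Finset.mem_erase] at hp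
    obtain ⟨hv, hwv, hw⟩ := hp
    dsimp only
    rw [Finset.erase_right_comm (a := w) (b := v), ← Finsupp.single_add]
    rcases lt_or_gt_of_ne hwv with h | h
    · rw [add_comm, main w v hw hv h, Finsupp.single_zero]
    · rw [main v w hv hw h, Finsupp.single_zero]
  · rintro ⟨v, w⟩ hp _ he
    simp only [Finset.mem_sigma, Finset.mem_erase] at hp
    simp only [Sigma.mk.injEq, heq_eq_eq] at he
    exact hp.2.1 he.1
  · rintro ⟨v, w⟩ hp
    simp only [Finset.mem_sigma, Finset.mem_erase] at hp ⊢
    exact ⟨hp.2.2, hp.2.1.symm, hp.1⟩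
  · rintro ⟨v, w⟩ hp
    rfl

theorem boundary_boundary (c : Finset V →₀ 𝕜) : boundary 𝕜 (boundary 𝕜 c) = 0 := by
  induction c using Finsupp.induction_linear with
  | zero => simp
  | add f g hf hg => rw [map_add, map_add, hf, hg, add_zero]
  | single σ a =>
    have : Finsupp.single σ a = a • Finsupp.single σ (1 : 𝕜) := by simp
    rw [this, map_smul, map_smul, boundary_single, boundary_boundarySimplex, smul_zero]

theorem boundary_mem_chains {Δ : PreAbstractSimplicialComplex V} {k : ℕ} {c : Finset V →₀ 𝕜}
    (hc : c ∈ chains 𝕜 Δ (k + 1)) : boundary 𝕜 c ∈ chains 𝕜 Δ k := by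
  classical
  rw [boundary, Finsupp.linearCombination_apply]
  refine Submodule.sum_mem _ fun σ hσ => Submodule.smul_mem _ _ ?_
  obtain ⟨hf, hcard⟩ := hc hσ
  rw [boundarySimplex, if_pos (by omega)]
  refine Submodule.sum_mem _ fun v hv => ?_
  have h1 : (σ.erase v).card = k + 1 := by rw [Finset.card_erase_of_mem hv]; omega
  refine Finsupp.single_mem_supported 𝕜 _ ⟨?_, h1⟩
  exact (Δ.isRelLowerSet_faces hf).2 (Finset.erase_subset v σ)
    (Finset.card_pos.1 (by omega))

/-- Boundaries are cycles. -/
theorem boundaries_le_cycles (Δ : PreAbstractSimplicialComplex V) (k : ℕ) :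
    boundaries 𝕜 Δ k ≤ cycles 𝕜 Δ k := by
  rintro _ ⟨c, hc, rfl⟩
  exact ⟨boundary_mem_chains 𝕜 hc, boundary_boundary 𝕜 c⟩

variable {𝕜} in
theorem cycles_mono {Δ Δ' : PreAbstractSimplicialComplex V} (h : Δ ≤ Δ') (k : ℕ) :
    cycles 𝕜 Δ k ≤ cycles 𝕜 Δ' k :=
  inf_le_inf_right _ (chains_mono h k)

variable {𝕜} in
theorem boundaries_mono {Δ Δ' : PreAbstractSimplicialComplex V} (h : Δ ≤ Δ') (k : ℕ) :
    boundaries 𝕜 Δ k ≤ boundaries 𝕜 Δ' k :=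
  Submodule.map_mono (chains_mono h (k + 1))

/-- The linear map `H_k(Δ; 𝕜) → H_k(Δ'; 𝕜)` induced by an inclusion `Δ ⊆ Δ'`: the class of a cycle
`z` of `Δ` goes to the class of `z` in `Δ'`. -/
noncomputable def homologyMap {Δ Δ' : PreAbstractSimplicialComplex V} (h : Δ ≤ Δ') (k : ℕ) :
    Homology 𝕜 Δ k →ₗ[𝕜] Homology 𝕜 Δ' k :=
  Subquotient.map (cycles_mono h k) (boundaries_mono h k)

theorem homologyMap_id (Δ : PreAbstractSimplicialComplex V) (k : ℕ) :
    homologyMap 𝕜 (le_refl Δ) k = LinearMap.id :=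
  Subquotient.map_id _ _

theorem homologyMap_comp {Δ Δ' Δ'' : PreAbstractSimplicialComplex V} (h : Δ ≤ Δ') (h' : Δ' ≤ Δ'')
    (k : ℕ) : (homologyMap 𝕜 h' k).comp (homologyMap 𝕜 h k) = homologyMap 𝕜 (h.trans h') k := by
  unfold homologyMap
  rw [Subquotient.map_comp]

/-- The `k`-th persistence module `ε ↦ H_k(Δ_ε; 𝕜)` of a filtration `(Δ_ε)` indexed by an ordered
set `I`, a functor from `I` to the category of vector spaces over `𝕜`. -/
noncomputable def persistenceModule {I : Type*} [Preorder I]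
    (Δ : I →o PreAbstractSimplicialComplex V) (k : ℕ) : CategoryTheory.Functor I (ModuleCat 𝕜) where
  obj i := ModuleCat.of 𝕜 (Homology 𝕜 (Δ i) k)
  map f := ModuleCat.ofHom (homologyMap 𝕜 (Δ.monotone (CategoryTheory.leOfHom f)) k)
  map_id i := by
    rw [homologyMap_id]
    rfl
  map_comp f g := by
    rw [← ModuleCat.ofHom_comp, homologyMap_comp]

end

end SimplicialHomology

/-! ### Finsler metrics and Čech complexes -/

section

variable {E : Type*}

/-- The Čech complex of a finite set `X` with respect to a ball `B p` around each point `p`: its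
vertex set is `X`, and a nonempty subset of `X` is a simplex if the balls around its elements have a
common point. -/
def cechComplex (X : Finset E) (B : E → Set E) : PreAbstractSimplicialComplex X where
  faces := {σ | σ.Nonempty ∧ (⋂ p ∈ σ, B (p : E)).Nonempty}
  isRelLowerSet_faces := by
    rintro σ ⟨h1, q, hq⟩
    refine ⟨h1, fun τ hτ h => ⟨h, q, ?_⟩⟩
    simp only [Set.mem_iInter] at hq ⊢
    exact fun p hp => hq p (hτ hp)

theorem cechComplex_mono (X : Finset E) {B B' : E → Set E} (h : ∀ p, B p ⊆ B' p) :
    cechComplex X B ≤ cechComplex X B' :=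
  fun _ hσ => ⟨hσ.1, hσ.2.mono (Set.iInter₂_mono fun p _ => h p)⟩

end

section

variable {E : Type*} [NormedAddCommGroup E] [NormedSpace ℝ E]

/-- A Finsler metric on an open subset `Ω` of a (finite-dimensional) real vector space `E`, whose
tangent bundle is `Ω × E`. Values `F x v` with `x ∉ Ω` are irrelevant. -/
structure FinslerMetric (Ω : Set E) where
  /-- the length `F x v` of the tangent vector `v` at the point `x` -/
  toFun : E → E → ℝ
  nonneg : ∀ x ∈ Ω, ∀ v, 0 ≤ toFun x v
  /-- `F` is smooth away from the zero section. -/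
  smooth : ContDiffOn ℝ ∞ (fun z : E × E => toFun z.1 z.2) (Ω ×ˢ {0}ᶜ)
  /-- `F` is positively homogeneous in the tangent vector. -/
  homogeneous : ∀ x ∈ Ω, ∀ v, ∀ t : ℝ, 0 < t → toFun x (t • v) = t * toFun x v
  /-- The Hessian of `F_x ^ 2` at every nonzero tangent vector `v` is positive definite. -/
  strongly_convex : ∀ x ∈ Ω, ∀ v, v ≠ 0 → ∀ w, w ≠ 0 →
    0 < fderiv ℝ (fderiv ℝ (fun u => toFun x u ^ 2)) v w w

namespace FinslerMetric

variable {Ω : Set E} (F : FinslerMetric Ω)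

/-- The open ball of radius `ε` around `p`: the points `q` of `Ω` at Finsler distance
`d_p(p, q) = F_p(q - p)` less than `ε` from `p`. -/
def ball (p : E) (ε : ℝ) : Set E := {q | q ∈ Ω ∧ F.toFun p (q - p) < ε}

/-- The closed ball of radius `ε` around `p`: the points `q` of `Ω` at Finsler distance
`d_p(p, q) = F_p(q - p)` at most `ε` from `p`. -/
def closedBall (p : E) (ε : ℝ) : Set E := {q | q ∈ Ω ∧ F.toFun p (q - p) ≤ ε}

theorem map_zero {p : E} (hp : p ∈ Ω) : F.toFun p 0 = 0 := by
  have h := F.homogeneous p hp 0 2 two_pos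
  rw [smul_zero] at h
  linarith

/-- The Čech filtration of `X`, with parameter `ε > 0`, built from open Finsler balls. -/
def cech (X : Finset E) : Set.Ioi (0 : ℝ) →o PreAbstractSimplicialComplex X where
  toFun ε := cechComplex X (fun p => F.ball p ε)
  monotone' _ _ h := cechComplex_mono X fun _ _ hq => ⟨hq.1, hq.2.trans_le h⟩

/-- The Čech filtration of `X`, with parameter `ε > 0`, built from closed Finsler balls. -/
def closedCech (X : Finset E) : Set.Ioi (0 : ℝ) →o PreAbstractSimplicialComplex X where
  toFun ε := cechComplex X (fun p => F.closedBall p ε)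
  monotone' _ _ h := cechComplex_mono X fun _ _ hq => ⟨hq.1, hq.2.trans h⟩

/-- Every point of `X` is a vertex of the Čech complexes. -/
theorem singleton_mem_cech (X : Finset E) (hX : (X : Set E) ⊆ Ω) (ε : Set.Ioi (0 : ℝ)) (p : X) :
    {p} ∈ (F.cech X ε).faces ∧ {p} ∈ (F.closedCech X ε).faces := by
  have hp : (p : E) ∈ Ω := hX p.2
  have hε : (0 : ℝ) < ε := ε.2
  refine ⟨⟨Finset.singleton_nonempty p, p, ?_⟩, ⟨Finset.singleton_nonempty p, p, ?_⟩⟩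
  · simp [ball, hp, F.map_zero hp, hε]
  · simp [closedBall, hp, F.map_zero hp, hε.le]

end FinslerMetric

end

/-!
Finsler balls are convex, and the nerve of finitely many convex sets in a space of dimension `n` has
no homology in degrees above `n`.

*Convexity of balls.* On a segment that misses the origin, `F_p ^ 2` is convex because its Hessian is
positive; a segment through the origin is handled by homogeneity. So `F_p` is quasiconvex
(`FinslerMetric.quasiconvexOn`).

*Nerves of convex sets.* The argument is an induction on the dimension that avoids the nerve theorem.
Replacing the sets by polytopes spanned by witnesses of the faces, one may assume that they are closed
(`exists_isClosed_convex_nerve_eq`). For a face `σ`, let `x σ` be the point of the intersection of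
its sets that is closest to the origin. Build up the nerve by adding the faces in order of
increasing `‖x σ‖`, all faces with the same point `x σ = a` at once. Each such step glues in the
simplex `τ` of all sets containing `a`, along the subcomplex of those faces of `τ` whose sets have a
common point in the open ball of radius `‖a‖`. As these sets are convex and contain `a`, this subcomplex
is the nerve of their slices by a hyperplane orthogonal to `a`, just below `a`. The slices live in
one dimension less, so by induction they have no homology in degree `k - 1` if `k > n`, and
a Mayer–Vietoris argument (`SimplicialHomology.cycles_le_boundaries_of_union_fullSimplex`) shows
that no homology in degree `k` is created. The step is `cycles_nerve_le_boundaries_of_slice`.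

Vanishing of homology is expressed throughout as `cycles 𝕜 Δ k ≤ boundaries 𝕜 Δ k`.
-/

/-! ### Acyclicity of simplices, and gluing in a simplex -/

namespace SimplicialHomology

section

variable {V : Type*} [LinearOrder V] (𝕜 : Type*) [Field 𝕜]

/-- The full simplex on the vertex set `τ`; it has no faces if `τ` is empty. -/
def fullSimplex (τ : Finset V) : PreAbstractSimplicialComplex V where
  faces := {σ | σ.Nonempty ∧ σ ⊆ τ}
  isRelLowerSet_faces := fun _ hσ => ⟨hσ.1, fun _ hρ h => ⟨h, hρ.trans hσ.2⟩⟩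

/-- The cone operator with apex `v`, on formal linear combinations of finite sets of vertices: it
sends `σ` to `σ ∪ {v}` if `v ∉ σ`, and to zero otherwise. No sign is needed when `v` lies below all
vertices of `σ`, the only case in which the operator is used. -/
noncomputable def cone (v : V) : (Finset V →₀ 𝕜) →ₗ[𝕜] (Finset V →₀ 𝕜) :=
  Finsupp.linearCombination 𝕜 fun σ => if v ∈ σ then 0 else Finsupp.single (insert v σ) 1

variable {𝕜}

theorem cone_single_of_mem {v : V} {σ : Finset V} (h : v ∈ σ) (a : 𝕜) :
    cone 𝕜 v (Finsupp.single σ a) = 0 := by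
  simp [cone, h]

theorem cone_single_of_notMem {v : V} {σ : Finset V} (h : v ∉ σ) (a : 𝕜) :
    cone 𝕜 v (Finsupp.single σ a) = Finsupp.single (insert v σ) a := by
  simp [cone, h]

variable (𝕜) in
theorem boundary_cone_single_add_cone_boundary_single {v : V} {σ : Finset V}
    (hσ : 2 ≤ σ.card) (hv : ∀ w ∈ σ, v ≤ w) :
    boundary 𝕜 (cone 𝕜 v (Finsupp.single σ 1)) + cone 𝕜 v (boundary 𝕜 (Finsupp.single σ 1)) =
      Finsupp.single σ 1 := by
  have hlow : σ.filter (fun w => w < v) = ∅ :=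
    Finset.filter_eq_empty_iff.2 fun w hw => (hv w hw).not_gt
  rw [boundary_single 𝕜 σ, boundarySimplex, if_pos hσ, map_sum]
  by_cases hvσ : v ∈ σ
  · rw [cone_single_of_mem hvσ, map_zero, zero_add, Finset.sum_eq_single_of_mem v hvσ, hlow,
      cone_single_of_notMem (Finset.notMem_erase v σ), Finset.insert_erase hvσ]
    · simp
    · intro w _ hwv
      exact cone_single_of_mem (Finset.mem_erase.2 ⟨hwv.symm, hvσ⟩) _
  · rw [cone_single_of_notMem hvσ, boundary_single, boundarySimplex,
      if_pos (hσ.trans (Finset.card_le_card (Finset.subset_insert v σ))),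
      Finset.sum_insert hvσ, Finset.erase_insert hvσ, Finset.filter_insert, if_neg (lt_irrefl v),
      hlow, add_assoc, ← Finset.sum_add_distrib, Finset.sum_eq_zero, add_zero]
    · simp
    · intro w hw
      have hwv : v ≠ w := fun h => hvσ (h ▸ hw)
      have hlt : v < w := (hv w hw).lt_of_ne hwv
      rw [cone_single_of_notMem (fun h => hvσ (Finset.mem_of_mem_erase h)),
        Finset.erase_insert_of_ne hwv, Finset.filter_insert, if_pos hlt,
        Finset.card_insert_of_notMem (fun h => hvσ (Finset.mem_of_mem_filter v h)),
        ← Finsupp.single_add, pow_succ]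
      simp

theorem boundary_cone_add_cone_boundary {v : V} {τ : Finset V} (hv : ∀ w ∈ τ, v ≤ w) {k : ℕ}
    {c : Finset V →₀ 𝕜} (hc : c ∈ chains 𝕜 (fullSimplex τ) (k + 1)) :
    boundary 𝕜 (cone 𝕜 v c) + cone 𝕜 v (boundary 𝕜 c) = c := by
  rw [chains, Finsupp.supported_eq_span_single] at hc
  induction hc using Submodule.span_induction with
  | mem x hx =>
    obtain ⟨σ, ⟨hσ, hcard⟩, rfl⟩ := hx
    exact boundary_cone_single_add_cone_boundary_single 𝕜 (by omega) fun w hw => hv w (hσ.2 hw)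
  | zero => simp
  | add x y _ _ hx hy =>
    rw [map_add, map_add, map_add, map_add, add_add_add_comm, hx, hy]
  | smul a x _ hx => rw [map_smul, map_smul, map_smul, map_smul, ← smul_add, hx]

theorem cycles_le_boundaries_of_isEmpty_faces {Δ : PreAbstractSimplicialComplex V}
    (h : ∀ σ, σ ∉ Δ.faces) (k : ℕ) : cycles 𝕜 Δ k ≤ boundaries 𝕜 Δ k := by
  rintro z ⟨hz, -⟩
  have : z = 0 := by
    rw [← Finsupp.support_eq_empty, Finset.eq_empty_iff_forall_notMem]
    exact fun σ hσ => h σ (hz hσ).1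
  rw [this]
  exact zero_mem _

/-- A simplex has no homology in positive degree: the cone operator with apex the lowest vertex is
a contracting homotopy. -/
theorem cycles_fullSimplex_le_boundaries (τ : Finset V) (k : ℕ) :
    cycles 𝕜 (fullSimplex τ) (k + 1) ≤ boundaries 𝕜 (fullSimplex τ) (k + 1) := by
  rintro z ⟨hz, hz0⟩
  rcases τ.eq_empty_or_nonempty with rfl | hτ
  · refine cycles_le_boundaries_of_isEmpty_faces (fun σ hσ => ?_) _ ⟨hz, hz0⟩
    exact hσ.1.ne_empty (Finset.subset_empty.1 hσ.2)
  set v := τ.min' hτ with hv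
  have hvτ : ∀ w ∈ τ, v ≤ w := fun w hw => τ.min'_le w hw
  have homotopy := boundary_cone_add_cone_boundary hvτ hz
  rw [LinearMap.mem_ker.1 hz0, map_zero, add_zero] at homotopy
  refine ⟨cone 𝕜 v z, ?_, homotopy⟩
  rw [SetLike.mem_coe, cone, Finsupp.linearCombination_apply]
  refine Submodule.sum_mem _ fun σ hσ => Submodule.smul_mem _ _ ?_
  obtain ⟨⟨-, hστ⟩, hcard⟩ := hz hσ
  split_ifs with h
  · exact zero_mem _
  · refine Finsupp.single_mem_supported 𝕜 _ ⟨⟨Finset.insert_nonempty v σ, ?_⟩, ?_⟩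
    · exact Finset.insert_subset (τ.min'_mem hτ) hστ
    · rw [Finset.card_insert_of_notMem h, hcard]

/-- The part of the Mayer–Vietoris sequence for a complex `Δ = Δ' ∪ 2 ^ τ` that is needed: if `Δ'`
has no homology in degree `k + 1` and `Δ' ∩ 2 ^ τ` none in degree `k`, then `Δ` has no homology in
degree `k + 1`. -/
theorem cycles_le_boundaries_of_union_fullSimplex {Δ Δ' : PreAbstractSimplicialComplex V}
    {τ : Finset V} (hΔ' : Δ' ≤ Δ) (hτ : fullSimplex τ ≤ Δ)
    (hcover : ∀ σ ∈ Δ.faces, σ ∈ Δ'.faces ∨ σ ⊆ τ) (k : ℕ)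
    (h' : cycles 𝕜 Δ' (k + 1) ≤ boundaries 𝕜 Δ' (k + 1))
    (hinter : cycles 𝕜 (Δ' ⊓ fullSimplex τ) k ≤ boundaries 𝕜 (Δ' ⊓ fullSimplex τ) k) :
    cycles 𝕜 Δ (k + 1) ≤ boundaries 𝕜 Δ (k + 1) := by
  classical
  rintro z ⟨hz, hz0⟩
  -- `z = z₁ + z₂` with `z₁` a chain of `Δ'` and `z₂` a chain of the simplex
  set z₁ := z.filter (fun σ => σ ∈ Δ'.faces) with hz₁_def
  set z₂ := z.filter (fun σ => ¬ σ ∈ Δ'.faces) with hz₂_def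
  have hadd : z₁ + z₂ = z := Finsupp.filter_add_filter_not z _
  have hz₁ : z₁ ∈ chains 𝕜 Δ' (k + 1) := by
    intro σ hσ
    rw [hz₁_def, Finset.mem_coe, Finsupp.support_filter, Finset.mem_filter] at hσ
    exact ⟨hσ.2, (hz hσ.1).2⟩
  have hz₂ : z₂ ∈ chains 𝕜 (fullSimplex τ) (k + 1) := by
    intro σ hσ
    rw [hz₂_def, Finset.mem_coe, Finsupp.support_filter, Finset.mem_filter] at hσ
    obtain ⟨h1, h2⟩ := hz hσ.1
    exact ⟨⟨(Δ.isRelLowerSet_faces h1).1, (hcover σ h1).resolve_left hσ.2⟩, h2⟩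
  -- the boundary of `z₂` is a cycle of the intersection, hence the boundary of some `u` there
  have hb : boundary 𝕜 z₂ = - boundary 𝕜 z₁ := by
    rw [eq_neg_iff_add_eq_zero, ← map_add, add_comm z₂, hadd]
    exact hz0
  have hw : boundary 𝕜 z₂ ∈ cycles 𝕜 (Δ' ⊓ fullSimplex τ) k := by
    refine ⟨fun σ hσ => ?_, boundary_boundary 𝕜 z₂⟩
    have h1 := boundary_mem_chains 𝕜 hz₂ hσ
    have h2 := neg_mem (boundary_mem_chains 𝕜 hz₁)
    rw [← hb] at h2
    exact ⟨⟨(h2 hσ).1, h1.1⟩, h1.2⟩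
  obtain ⟨u, hu, hub⟩ := hinter hw
  -- `z₂ - u` is a boundary in the simplex and `z₁ + u` is a boundary in `Δ'`
  have h2 : z₂ - u ∈ boundaries 𝕜 (fullSimplex τ) (k + 1) := by
    refine cycles_fullSimplex_le_boundaries τ k ⟨sub_mem hz₂ (chains_mono inf_le_right _ hu), ?_⟩
    rw [SetLike.mem_coe, LinearMap.mem_ker, map_sub, hub, sub_self]
  have h1 : z₁ + u ∈ boundaries 𝕜 Δ' (k + 1) := by
    refine h' ⟨add_mem hz₁ (chains_mono inf_le_left _ hu), ?_⟩
    rw [SetLike.mem_coe, LinearMap.mem_ker, map_add, hub, hb, add_neg_cancel]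
  have hsum : z = (z₁ + u) + (z₂ - u) := by rw [add_add_sub_cancel, hadd]
  rw [hsum]
  exact add_mem (boundaries_mono hΔ' _ h1) (boundaries_mono hτ _ h2)

variable (𝕜) in
theorem subsingleton_homology_of_cycles_le_boundaries {Δ : PreAbstractSimplicialComplex V} {k : ℕ}
    (h : cycles 𝕜 Δ k ≤ boundaries 𝕜 Δ k) : Subsingleton (Homology 𝕜 Δ k) := by
  refine ⟨fun x y => ?_⟩
  obtain ⟨x, rfl⟩ := Submodule.Quotient.mk_surjective _ x
  obtain ⟨y, rfl⟩ := Submodule.Quotient.mk_surjective _ y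
  exact (Submodule.Quotient.eq _).2 (h (x - y).2)

variable (𝕜) in
theorem isZero_persistenceModule {I : Type*} [Preorder I] (Δ : I →o PreAbstractSimplicialComplex V)
    {k : ℕ} (h : ∀ i, Subsingleton (Homology 𝕜 (Δ i) k)) :
    CategoryTheory.Limits.IsZero (persistenceModule 𝕜 Δ k) :=
  CategoryTheory.Functor.isZero _ fun i =>
    have : Subsingleton ((persistenceModule 𝕜 Δ k).obj i) := h i
    ModuleCat.isZero_of_subsingleton _

end

end SimplicialHomology

/-! ### Nerves of convex sets -/

section

variable {V : Type*} {E : Type*}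

/-- The nerve of a family of sets `K v`: a nonempty finite set `σ` of indices is a face if the sets
`K v` with `v ∈ σ` have a common point. -/
def nerve (K : V → Set E) : PreAbstractSimplicialComplex V where
  faces := {σ | σ.Nonempty ∧ (⋂ v ∈ σ, K v).Nonempty}
  isRelLowerSet_faces := fun _ hσ =>
    ⟨hσ.1, fun _ hρ h => ⟨h, hσ.2.mono (Set.biInter_subset_biInter_left hρ)⟩⟩

theorem mem_nerve_iff {K : V → Set E} {σ : Finset V} :
    σ ∈ (nerve K).faces ↔ σ.Nonempty ∧ ∃ y, ∀ v ∈ σ, y ∈ K v := by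
  simp only [nerve, Set.mem_ofPred_eq, Set.Nonempty, Set.mem_iInter]

/-- A family of convex sets may be shrunk to a family of polytopes with the same nerve: pick a
witness for each face of the nerve, and take the convex hulls of these witnesses. -/
theorem exists_isClosed_convex_nerve_eq [Finite V] [NormedAddCommGroup E] [NormedSpace ℝ E]
    (K : V → Set E) (hK : ∀ v, Convex ℝ (K v)) :
    ∃ K' : V → Set E, (∀ v, Convex ℝ (K' v)) ∧ (∀ v, IsClosed (K' v)) ∧ nerve K' = nerve K := by
  have hw : ∀ σ : (nerve K).faces, ∃ y, ∀ v ∈ σ.1, y ∈ K v := fun σ => (mem_nerve_iff.1 σ.2).2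
  choose y hy using hw
  refine ⟨fun v => convexHull ℝ (y '' {σ | v ∈ σ.1}), fun v => convex_convexHull ℝ _,
    fun v => (Set.toFinite _).isClosed_convexHull ℝ, ?_⟩
  ext σ
  rw [mem_nerve_iff, mem_nerve_iff]
  refine and_congr_right fun hσ => ⟨?_, fun h => ?_⟩
  · rintro ⟨q, hq⟩
    refine ⟨q, fun v hv => convexHull_min ?_ (hK v) (hq v hv)⟩
    rintro _ ⟨ρ, hρ, rfl⟩
    exact hy ρ v hρ
  · exact ⟨y ⟨σ, mem_nerve_iff.2 ⟨hσ, h⟩⟩, fun v hv =>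
      subset_convexHull ℝ _ (Set.mem_image_of_mem y (show v ∈ σ from hv))⟩

end

section

variable {E : Type*} [NormedAddCommGroup E] [InnerProductSpace ℝ E]

/-- A closed convex set has a point closest to the origin; it is characterized by a variational
inequality. -/
theorem exists_norm_sq_le_inner [FiniteDimensional ℝ E] {C : Set E} (hne : C.Nonempty)
    (hcl : IsClosed C) (hC : Convex ℝ C) : ∃ x ∈ C, ∀ y ∈ C, ‖x‖ ^ 2 ≤ inner ℝ x y := by
  have : CompleteSpace E := FiniteDimensional.complete ℝ E
  obtain ⟨x, hx, hmin⟩ := exists_norm_eq_iInf_of_complete_convex hne hcl.isComplete hC 0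
  refine ⟨x, hx, fun y hy => ?_⟩
  have h := (norm_eq_iInf_iff_real_inner_le_zero hC hx).1 hmin y hy
  rw [zero_sub, inner_neg_left, inner_sub_right, real_inner_self_eq_norm_sq] at h
  linarith

theorem norm_le_of_norm_sq_le_inner {x y : E} (h : ‖x‖ ^ 2 ≤ inner ℝ x y) : ‖x‖ ≤ ‖y‖ := by
  rcases (norm_nonneg x).eq_or_lt with h0 | h0
  · rw [← h0]
    exact norm_nonneg y
  · have := real_inner_le_norm x y
    exact le_of_mul_le_mul_left (by rw [← sq]; exact h.trans this) h0

theorem eq_of_norm_sq_le_inner {x y : E} (h : ‖x‖ ^ 2 ≤ inner ℝ x y) (hyx : ‖y‖ ≤ ‖x‖) :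
    y = x := by
  have h1 := norm_sub_sq_real y x
  rw [real_inner_comm] at h1
  have h2 : ‖y‖ ^ 2 ≤ ‖x‖ ^ 2 := pow_le_pow_left₀ (norm_nonneg y) hyx 2
  have h3 : ‖y - x‖ ^ 2 = 0 := le_antisymm (by linarith) (sq_nonneg _)
  exact sub_eq_zero.1 (norm_eq_zero.1 (pow_eq_zero_iff two_ne_zero |>.1 h3))

open Filter Topology in
theorem exists_lt_one_forall_le_mul {ι : Type*} [Finite ι] (r : ℝ) (f : ι → ℝ) :
    ∃ c < 1, ∀ i, f i < r → f i ≤ c * r := by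
  have h : ∀ᶠ c : ℝ in 𝓝[<] 1, ∀ i, f i < r → f i ≤ c * r := by
    refine eventually_all.2 fun i => ?_
    by_cases hi : f i < r
    · have ht : Tendsto (fun c : ℝ => c * r) (𝓝[<] 1) (𝓝 (1 * r)) :=
        ((continuous_id.mul continuous_const).tendsto 1).mono_left nhdsWithin_le_nhds
      rw [one_mul] at ht
      filter_upwards [ht.eventually_const_lt hi] with c hc _ using hc.le
    · exact Eventually.of_forall fun _ h => absurd h hi
  obtain ⟨c, hc, hc1⟩ := (h.and self_mem_nhdsWithin).exists
  exact ⟨c, hc1, hc⟩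

/-- The slices of the sets `K v` that contain `a`, by the hyperplane through `c • a` orthogonal to
`a`. The hyperplane is identified with the orthogonal complement of `a`, by translation. -/
def slice {V : Type*} (K : V → Set E) (a : E) (c : ℝ) (v : V) : Set (ℝ ∙ a)ᗮ :=
  {w | a ∈ K v ∧ c • a + (w : E) ∈ K v}

theorem convex_slice {V : Type*} {K : V → Set E} (hK : ∀ v, Convex ℝ (K v)) (a : E) (c : ℝ)
    (v : V) : Convex ℝ (slice K a c v) := by
  rintro w ⟨ha, hw⟩ w' ⟨-, hw'⟩ s t hs ht hst
  refine ⟨ha, ?_⟩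
  have h := hK v hw hw' hs ht hst
  rw [smul_add, smul_add, add_add_add_comm, ← add_smul, hst, one_smul] at h
  exact h

theorem isClosed_slice {V : Type*} {K : V → Set E} (hK : ∀ v, IsClosed (K v)) (a : E) (c : ℝ)
    (v : V) : IsClosed (slice K a c v) :=
  isClosed_const.and ((hK v).preimage (continuous_const.add continuous_subtype_val))

open SimplicialHomology

variable {V : Type*} [LinearOrder V] [Finite V] {𝕜 : Type*} [Field 𝕜]

/-- The induction step on the dimension. If the slices of a family of closed convex sets have no
homology in degree `k`, then the family has none in degree `k + 1`.

Order the faces `σ` of the nerve by the norm of the point `x σ` of `⋂ v ∈ σ, K v` closest to the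
origin. The faces `σ` with `x σ = a` lie in the simplex `τ` of all `v` with `a ∈ K v`, and the other
faces of `τ` are those whose sets meet the open half-space `⟪a, ·⟫ < ‖a‖ ^ 2`, since a point in the
half-space can be moved towards `a` into the open ball of radius `‖a‖`. By convexity these are the
faces whose sets meet a hyperplane in the half-space close to `a`. -/
theorem cycles_nerve_le_boundaries_of_slice [FiniteDimensional ℝ E] {K : V → Set E}
    (hK : ∀ v, Convex ℝ (K v)) (hcl : ∀ v, IsClosed (K v)) (k : ℕ)
    (hslice : ∀ a : E, a ≠ 0 → ∀ c : ℝ,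
      cycles 𝕜 (nerve (slice K a c)) k ≤ boundaries 𝕜 (nerve (slice K a c)) k) :
    cycles 𝕜 (nerve K) (k + 1) ≤ boundaries 𝕜 (nerve K) (k + 1) := by
  classical
  have hx : ∀ σ : Finset V, ∃ x : E, σ ∈ (nerve K).faces →
      (∀ v ∈ σ, x ∈ K v) ∧ ∀ y, (∀ v ∈ σ, y ∈ K v) → ‖x‖ ^ 2 ≤ inner ℝ x y := by
    intro σ
    by_cases hσ : σ ∈ (nerve K).faces
    · obtain ⟨x, hx, hmin⟩ := exists_norm_sq_le_inner hσ.2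
        (isClosed_biInter fun v _ => hcl v) (convex_iInter₂ fun v _ => hK v)
      simp only [Set.mem_iInter] at hx hmin
      exact ⟨x, fun _ => ⟨hx, hmin⟩⟩
    · exact ⟨0, fun h => absurd h hσ⟩
  choose x hx using hx
  have hmem : ∀ σ ∈ (nerve K).faces, ∀ v ∈ σ, x σ ∈ K v := fun σ hσ => (hx σ hσ).1
  have hmin : ∀ σ ∈ (nerve K).faces, ∀ y, (∀ v ∈ σ, y ∈ K v) → ‖x σ‖ ^ 2 ≤ inner ℝ (x σ) y :=
    fun σ hσ => (hx σ hσ).2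
  -- The claim holds for every subcomplex `Δ` that is an initial segment of the nerve in the order
  -- given by `‖x σ‖`, and that contains all or none of the faces with a given closest point.
  suffices claim : ∀ m, ∀ Δ : PreAbstractSimplicialComplex V, Δ.faces.ncard = m → Δ ≤ nerve K →
      (∀ σ ∈ Δ.faces, ∀ ρ ∈ (nerve K).faces, ‖x ρ‖ < ‖x σ‖ ∨ x ρ = x σ → ρ ∈ Δ.faces) →
      cycles 𝕜 Δ (k + 1) ≤ boundaries 𝕜 Δ (k + 1) from
    claim _ (nerve K) rfl le_rfl fun _ _ ρ hρ _ => hρ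
  intro m
  induction m using Nat.strong_induction_on with
  | _ m ih =>
  intro Δ hm hΔ hsat
  rcases Δ.faces.eq_empty_or_nonempty with hempty | hne
  · exact cycles_le_boundaries_of_isEmpty_faces (fun σ hσ => by simp [hempty] at hσ) _
  obtain ⟨σ, hσ, hmax⟩ := Set.exists_max_image Δ.faces (fun ρ => ‖x ρ‖) (Set.toFinite _) hne
  set a := x σ with ha
  -- remove the faces with closest point `a`
  let Δ' : PreAbstractSimplicialComplex V :=
    { faces := {ρ | ρ ∈ Δ.faces ∧ x ρ ≠ a}
      isRelLowerSet_faces := by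
        rintro ρ ⟨hρ, hρa⟩
        refine ⟨(Δ.isRelLowerSet_faces hρ).1, fun π hπ hπne => ?_⟩
        have hπΔ := (Δ.isRelLowerSet_faces hρ).2 hπ hπne
        refine ⟨hπΔ, fun h => hρa ?_⟩
        have h1 := hmin π (hΔ hπΔ) (x ρ) fun v hv => hmem ρ (hΔ hρ) v (hπ hv)
        rw [h] at h1
        exact eq_of_norm_sq_le_inner h1 (hmax ρ hρ) }
  have hΔ' : Δ' ≤ Δ := fun ρ hρ => hρ.1
  let τ : Finset V := (Set.toFinite {v | a ∈ K v}).toFinset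
  have hmemτ : ∀ v, v ∈ τ ↔ a ∈ K v := fun v => by simp [τ]
  have hface : ∀ ρ : Finset V, ρ.Nonempty → ρ ⊆ τ → ρ ∈ Δ.faces := by
    intro ρ hρ hρτ
    have haρ : ∀ v ∈ ρ, a ∈ K v := fun v hv => (hmemτ v).1 (hρτ hv)
    have hρN : ρ ∈ (nerve K).faces := mem_nerve_iff.2 ⟨hρ, a, haρ⟩
    have h1 := hmin ρ hρN a haρ
    refine hsat σ hσ ρ hρN ?_
    rcases (norm_le_of_norm_sq_le_inner h1).lt_or_eq with h | h
    · exact Or.inl h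
    · exact Or.inr (eq_of_norm_sq_le_inner h1 h.ge).symm
  refine cycles_le_boundaries_of_union_fullSimplex (Δ' := Δ') (τ := τ) hΔ'
    (fun ρ hρ => hface ρ hρ.1 hρ.2) ?_ k ?_ ?_
  · intro ρ hρ
    by_cases h : x ρ = a
    · exact Or.inr fun v hv => (hmemτ v).2 (h ▸ hmem ρ (hΔ hρ) v hv)
    · exact Or.inl ⟨hρ, h⟩
  · refine ih _ ?_ Δ' rfl (hΔ'.trans hΔ) ?_
    · rw [← hm]
      refine Set.ncard_lt_ncard ⟨hΔ', fun h => (h hσ).2 rfl⟩ (Set.toFinite _)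
    · rintro ρ ⟨hρ, hρa⟩ π hπ h
      refine ⟨hsat ρ hρ π hπ h, fun hπa => ?_⟩
      rw [hπa] at h
      rcases h with h | h
      · exact (hmax ρ hρ).not_gt h
      · exact hρa h.symm
  by_cases ha0 : a = 0
  · -- all closest points are the origin
    refine cycles_le_boundaries_of_isEmpty_faces (fun ρ hρ => ?_) _
    refine hρ.1.2 ?_
    have h := hmax ρ hρ.1.1
    rw [ha0, norm_zero] at h
    rw [ha0]
    exact norm_le_zero_iff.1 h
  have hapos : 0 < ‖a‖ ^ 2 := pow_pos (norm_pos_iff.2 ha0) 2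
  obtain ⟨c, hc1, hc⟩ := exists_lt_one_forall_le_mul (‖a‖ ^ 2) fun ρ => inner ℝ a (x ρ)
  suffices heq : Δ' ⊓ fullSimplex τ = nerve (slice K a c) by
    rw [heq]
    exact hslice a ha0 c
  ext ρ
  rw [mem_nerve_iff]
  constructor
  · rintro ⟨⟨hρ, hρa⟩, hρne, hρτ⟩
    refine ⟨hρne, ?_⟩
    have hρN := hΔ hρ
    have haρ : ∀ v ∈ ρ, a ∈ K v := fun v hv => (hmemτ v).1 (hρτ hv)
    have hlt : ‖x ρ‖ < ‖a‖ := by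
      by_contra! h
      exact hρa (eq_of_norm_sq_le_inner (hmin ρ hρN a haρ) h).symm
    have hinner : inner ℝ a (x ρ) < ‖a‖ ^ 2 :=
      calc inner ℝ a (x ρ) ≤ ‖a‖ * ‖x ρ‖ := real_inner_le_norm _ _
        _ < ‖a‖ * ‖a‖ := mul_lt_mul_of_pos_left hlt (norm_pos_iff.2 ha0)
        _ = ‖a‖ ^ 2 := (sq _).symm
    have hcρ := hc ρ hinner
    -- the segment from `a` to `x ρ` meets the hyperplane
    have hd : 0 < ‖a‖ ^ 2 - inner ℝ a (x ρ) := sub_pos.2 hinner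
    set t := (1 - c) * ‖a‖ ^ 2 / (‖a‖ ^ 2 - inner ℝ a (x ρ)) with ht
    have htd : t * (‖a‖ ^ 2 - inner ℝ a (x ρ)) = (1 - c) * ‖a‖ ^ 2 := div_mul_cancel₀ _ hd.ne'
    have ht0 : 0 ≤ t := div_nonneg (mul_nonneg (by linarith) hapos.le) hd.le
    have ht1 : t ≤ 1 := (div_le_one hd).2 (by linarith)
    have hw : (1 - t) • a + t • x ρ - c • a ∈ (ℝ ∙ a)ᗮ := by
      rw [Submodule.mem_orthogonal_singleton_iff_inner_right, inner_sub_right, inner_add_right,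
        inner_smul_right, inner_smul_right, inner_smul_right, real_inner_self_eq_norm_sq]
      linarith
    refine ⟨⟨_, hw⟩, fun v hv => ⟨haρ v hv, ?_⟩⟩
    rw [add_sub_cancel]
    exact hK v (haρ v hv) (hmem ρ hρN v hv) (sub_nonneg.2 ht1) ht0 (sub_add_cancel 1 t)
  · rintro ⟨hρne, w, hw⟩
    have hρτ : ρ ⊆ τ := fun v hv => (hmemτ v).2 (hw v hv).1
    have hρ := hface ρ hρne hρτ
    refine ⟨⟨hρ, fun h => ?_⟩, hρne, hρτ⟩
    have h1 := hmin ρ (hΔ hρ) (c • a + w) fun v hv => (hw v hv).2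
    rw [h, inner_add_right, inner_smul_right, real_inner_self_eq_norm_sq,
      Submodule.mem_orthogonal_singleton_iff_inner_right.1 w.2, add_zero] at h1
    nlinarith

theorem cycles_nerve_le_boundaries_of_isClosed (n : ℕ) :
    ∀ {E : Type*} [NormedAddCommGroup E] [InnerProductSpace ℝ E] [FiniteDimensional ℝ E],
      Module.finrank ℝ E ≤ n → ∀ {K : V → Set E}, (∀ v, Convex ℝ (K v)) → (∀ v, IsClosed (K v)) →
      ∀ {k : ℕ}, n < k → cycles 𝕜 (nerve K) k ≤ boundaries 𝕜 (nerve K) k := by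
  induction n with
  | zero =>
    intro E _ _ _ hn K hK hcl k hk
    obtain ⟨k, rfl⟩ := Nat.exists_eq_succ_of_ne_zero hk.ne'
    have : Subsingleton E := Module.finrank_zero_iff.1 (Nat.le_zero.1 hn)
    exact cycles_nerve_le_boundaries_of_slice hK hcl k
      fun a ha => absurd (Subsingleton.elim a 0) ha
  | succ n ih =>
    intro E _ _ _ hn K hK hcl k hk
    obtain ⟨k, rfl⟩ := Nat.exists_eq_succ_of_ne_zero (n.succ_pos.trans hk).ne'
    refine cycles_nerve_le_boundaries_of_slice hK hcl k fun a ha c =>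
      ih ?_ (convex_slice hK a c) (isClosed_slice hcl a c) (Nat.lt_of_succ_lt_succ hk)
    have h := (ℝ ∙ a).finrank_add_finrank_orthogonal
    rw [finrank_span_singleton ha] at h
    omega

/-- The nerve of finitely many convex sets in a space of dimension `n` has no homology in degrees
above `n`. -/
theorem cycles_nerve_le_boundaries [FiniteDimensional ℝ E] {K : V → Set E}
    (hK : ∀ v, Convex ℝ (K v)) {k : ℕ} (hk : Module.finrank ℝ E < k) :
    cycles 𝕜 (nerve K) k ≤ boundaries 𝕜 (nerve K) k := by
  obtain ⟨K', hK', hcl, heq⟩ := exists_isClosed_convex_nerve_eq K hK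
  rw [← heq]
  exact cycles_nerve_le_boundaries_of_isClosed _ le_rfl hK' hcl hk

end

/-! ### Convexity of Finsler balls -/

namespace FinslerMetric

variable {E : Type*} [NormedAddCommGroup E] [NormedSpace ℝ E] {Ω : Set E} (F : FinslerMetric Ω)

theorem contDiffOn_sq {p : E} (hp : p ∈ Ω) :
    ContDiffOn ℝ ∞ (fun u => F.toFun p u ^ 2) {0}ᶜ := by
  have h : ContDiffOn ℝ ∞ (fun u => F.toFun p u) {0}ᶜ :=
    F.smooth.comp (f := fun u => (p, u)) (contDiff_prodMk_right p).contDiffOn fun u hu => ⟨hp, hu⟩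
  exact h.pow 2

theorem toFun_smul_le {p : E} (hp : p ∈ Ω) {t : ℝ} (ht0 : 0 ≤ t) (ht1 : t ≤ 1) (v : E) :
    F.toFun p (t • v) ≤ F.toFun p v := by
  rcases ht0.eq_or_lt with rfl | ht0
  · rw [zero_smul, F.map_zero hp]
    exact F.nonneg p hp v
  · rw [F.homogeneous p hp v t ht0]
    exact mul_le_of_le_one_left (F.nonneg p hp v) ht1

theorem convexOn_sq_segment {p : E} (hp : p ∈ Ω) {v w : E}
    (h0 : (0 : E) ∉ segment ℝ v w) : ConvexOn ℝ (segment ℝ v w) fun u => F.toFun p u ^ 2 := by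
  set G : E → ℝ := fun u => F.toFun p u ^ 2 with hG
  have hsmooth : ∀ u ≠ 0, ContDiffAt ℝ ∞ G u := fun u hu =>
    (F.contDiffOn_sq hp).contDiffAt (isOpen_compl_singleton.mem_nhds hu)
  refine ⟨convex_segment v w, fun x hx y hy s t hs ht hst => ?_⟩
  have hne : ∀ r ∈ Set.Icc (0 : ℝ) 1, x + r • (y - x) ≠ 0 := fun r hr h =>
    h0 (h ▸ (convex_segment v w).add_smul_sub_mem hx hy hr)
  have hγ : ∀ r : ℝ, HasDerivAt (fun r : ℝ => x + r • (y - x)) (y - x) r := fun r => by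
    simpa using ((hasDerivAt_id r).smul_const (y - x)).const_add x
  have hd1 : ∀ r ∈ Set.Icc (0 : ℝ) 1, HasDerivAt (fun r : ℝ => G (x + r • (y - x)))
      (fderiv ℝ G (x + r • (y - x)) (y - x)) r := fun r hr =>
    HasFDerivAt.comp_hasDerivAt (l := G) r
      ((hsmooth _ (hne r hr)).differentiableAt (by simp)).hasFDerivAt (hγ r)
  have hd2 : ∀ r ∈ Set.Icc (0 : ℝ) 1,
      HasDerivAt (fun r : ℝ => fderiv ℝ G (x + r • (y - x)) (y - x))
        (fderiv ℝ (fderiv ℝ G) (x + r • (y - x)) (y - x) (y - x)) r := fun r hr => by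
    have h : DifferentiableAt ℝ (fderiv ℝ G) (x + r • (y - x)) :=
      ((hsmooth _ (hne r hr)).fderiv_right (m := 1) (by norm_cast)).differentiableAt (by simp)
    have h' := HasFDerivAt.comp_hasDerivAt (l := fderiv ℝ G) r h.hasFDerivAt (hγ r)
    simpa using h'.clm_apply (hasDerivAt_const r (y - x))
  have hconv : ConvexOn ℝ (Set.Icc (0 : ℝ) 1) fun r : ℝ => G (x + r • (y - x)) := by
    refine convexOn_of_hasDerivWithinAt2_nonneg (convex_Icc 0 1)
      (fun r hr => (hd1 r hr).continuousAt.continuousWithinAt)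
      (fun r hr => (hd1 r (interior_subset hr)).hasDerivWithinAt)
      (fun r hr => (hd2 r (interior_subset hr)).hasDerivWithinAt) fun r hr => ?_
    rcases eq_or_ne (y - x) 0 with h | h
    · simp [h]
    · exact (F.strongly_convex p hp _ (hne r (interior_subset hr)) _ h).le
  have h := hconv.2 (Set.left_mem_Icc.2 zero_le_one) (Set.right_mem_Icc.2 zero_le_one) hs ht hst
  have hs' : s = 1 - t := by linarith
  have hxy : s • x + t • y = x + t • (y - x) := by
    rw [hs', sub_smul, one_smul, smul_sub]
    abel
  simpa [hxy] using h

/-- On a segment that misses the origin, `F_p ^ 2` has positive second derivative. On a segment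
through the origin, `F_p` is linear on either side of the origin, where it vanishes. -/
theorem quasiconvexOn {p : E} (hp : p ∈ Ω) :
    QuasiconvexOn ℝ Set.univ (F.toFun p) := by
  refine quasiconvexOn_iff_le_max.2 ⟨convex_univ, fun v _ w _ s t hs ht hst => ?_⟩
  by_cases h0 : (0 : E) ∈ segment ℝ v w
  · obtain ⟨a, b, ha, hb, hab, h0⟩ := h0
    have hz1 : b • (s • v + t • w) = (s * b - t * a) • v := by
      have : b • w = -(a • v) := eq_neg_of_add_eq_zero_right h0
      rw [smul_add, smul_comm b t w, this, smul_neg, smul_smul, smul_smul, sub_smul, sub_eq_add_neg,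
        mul_comm b s]
    have hz2 : a • (s • v + t • w) = (t * a - s * b) • w := by
      have : a • v = -(b • w) := eq_neg_of_add_eq_zero_left h0
      rw [smul_add, smul_comm a s v, this, smul_neg, smul_smul, smul_smul, sub_smul, sub_eq_add_neg,
        mul_comm a t, add_comm]
    rcases le_or_gt (t * a) (s * b) with h | h
    · refine le_max_of_le_left ?_
      rcases hb.eq_or_lt with rfl | hb
      · have ht0 : t = 0 := by
          rw [add_zero] at hab
          rw [hab] at h
          linarith
        rw [ht0, add_zero] at hst
        rw [ht0, hst, one_smul, zero_smul, add_zero]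
      · have hz : s • v + t • w = ((s * b - t * a) / b) • v := by
          rw [div_eq_inv_mul, mul_smul, ← hz1, inv_smul_smul₀ hb.ne']
        rw [hz]
        refine F.toFun_smul_le hp (div_nonneg (sub_nonneg.2 h) hb.le) ((div_le_one hb).2 ?_) v
        nlinarith
    · refine le_max_of_le_right ?_
      have ha : 0 < a := by
        rcases ha.eq_or_lt with rfl | ha
        · nlinarith
        · exact ha
      have hz : s • v + t • w = ((t * a - s * b) / a) • w := by
        rw [div_eq_inv_mul, mul_smul, ← hz2, inv_smul_smul₀ ha.ne']
      rw [hz]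
      refine F.toFun_smul_le hp (div_nonneg (sub_nonneg.2 h.le) ha.le) ((div_le_one ha).2 ?_) w
      nlinarith
  · have hz := quasiconvexOn_iff_le_max.1 (F.convexOn_sq_segment hp h0).quasiconvexOn |>.2
      (left_mem_segment ℝ v w) (right_mem_segment ℝ v w) hs ht hst
    have hv := F.nonneg p hp v
    have hw := F.nonneg p hp w
    refine (pow_le_pow_iff_left₀ (F.nonneg p hp _) (le_max_of_le_left hv) two_ne_zero).1
      (hz.trans (max_le ?_ ?_))
    · exact pow_le_pow_left₀ hv (le_max_left _ _) 2
    · exact pow_le_pow_left₀ hw (le_max_right _ _) 2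

theorem convex_ball (hΩc : Convex ℝ Ω) {p : E} (hp : p ∈ Ω) (ε : ℝ) :
    Convex ℝ (F.ball p ε) := by
  have h := hΩc.inter (((F.quasiconvexOn hp).convex_lt ε).translate_preimage_right (-p))
  convert h using 1
  ext q
  simp [ball, sub_eq_neg_add]

theorem convex_closedBall (hΩc : Convex ℝ Ω) {p : E} (hp : p ∈ Ω) (ε : ℝ) :
    Convex ℝ (F.closedBall p ε) := by
  have h := hΩc.inter ((F.quasiconvexOn hp ε).translate_preimage_right (-p))
  convert h using 1
  ext q
  simp [closedBall, sub_eq_neg_add]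

end FinslerMetric

theorem corollary3p3 {n : ℕ} {Ω : Set (EuclideanSpace ℝ (Fin n))}
    (hΩ : IsOpen Ω) (hΩc : Convex ℝ Ω) (F : FinslerMetric Ω)
    (X : Finset (EuclideanSpace ℝ (Fin n))) (hX : (X : Set (EuclideanSpace ℝ (Fin n))) ⊆ Ω)
    [LinearOrder X] (𝕜 : Type*) [Field 𝕜] (k : ℕ) (hk : n < k) :
    ((∀ ε : Set.Ioi (0 : ℝ), Subsingleton (SimplicialHomology.Homology 𝕜 (F.cech X ε) k)) ∧
      CategoryTheory.Limits.IsZero (SimplicialHomology.persistenceModule 𝕜 (F.cech X) k)) ∧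
    ((∀ ε : Set.Ioi (0 : ℝ), Subsingleton (SimplicialHomology.Homology 𝕜 (F.closedCech X ε) k)) ∧
      CategoryTheory.Limits.IsZero
        (SimplicialHomology.persistenceModule 𝕜 (F.closedCech X) k)) := by
  have hk' : Module.finrank ℝ (EuclideanSpace ℝ (Fin n)) < k := by
    rwa [finrank_euclideanSpace_fin]
  have hopen : ∀ ε, Subsingleton (SimplicialHomology.Homology 𝕜 (F.cech X ε) k) := fun ε =>
    SimplicialHomology.subsingleton_homology_of_cycles_le_boundaries 𝕜
      (cycles_nerve_le_boundaries (fun p : X => F.convex_ball hΩc (hX p.2) ε) hk')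
  have hclosed : ∀ ε, Subsingleton (SimplicialHomology.Homology 𝕜 (F.closedCech X ε) k) := fun ε =>
    SimplicialHomology.subsingleton_homology_of_cycles_le_boundaries 𝕜
      (cycles_nerve_le_boundaries (fun p : X => F.convex_closedBall hΩc (hX p.2) ε) hk')
  exact ⟨⟨hopen, SimplicialHomology.isZero_persistenceModule 𝕜 _ hopen⟩,
    hclosed, SimplicialHomology.isZero_persistenceModule 𝕜 _ hclosed⟩
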